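/- Let $X$ be a topological space. A set $F\subseteq X$ is regular closed if $F=\operatorname{cl}(\operatorname{int}F)$; let $RC(X)$ be the set of all regular closed subsets of $X$, a Boolean algebra with order $\subseteq$, join $F\cup G$, meet $\operatorname{cl}(\operatorname{int}(F\cap G))$, complement $\operatorname{cl}(X\setminus F)$, zero $\emptyset$ and unit $X$. For $F,G\in RC(X)$ write $F\,C_X\,G$ if $F\cap G\neq\emptyset$. A clan of $(RC(X),C_X)$ is a non-empty $\Gamma\subseteq RC(X)$ such that (1) $\emptyset\notin\Gamma$; (2) if $F\in\Gamma$, $G\in RC(X)$ and $F\subseteq G$, then $G\in\Gamma$; (3) if $F,G\in RC(X)$ and $F\cup G\in\Gamma$, then $F\in\Gamma$ or $G\in\Gamma$; (4) if $F,G\in\Gamma$, then $F\,C_X\,G$. For $x\in X$ put $\sigma_x=\{F\in RC(X): x\in F\}$. The space $X$ is called C-semiregular if it is a $T_0$-space, every closed subset of $X$ is an intersection of regular closed sets (that is, $X$ is semiregular), and every clan $\Gamma$ of $(RC(X),C_X)$ is equal to $\sigma_x$ for some $x\in X$. A point $x\in X$ is a u-point if for all open $U,V\subseteq X$, $x\in\operatorname{cl}(U)\cap\operatorname{cl}(V)$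 implies $x\in\operatorname{cl}(U\cap V)$. A space is extremally disconnected if the closure of each of its open sets is open; neither compactness nor extremal disconnectedness includes the Hausdorff axiom. **Theorem.** Let $X$ be a C-semiregular space and let $X_0$ be the set of all u-points of $X$. Then $X_0$ is dense in $X$, and with the subspace topology it is an extremally disconnected compact Hausdorff space. Moreover, $X_0$ is the only such subset: if $Y\subseteq X$ is dense in $X$ and is, with the subspace topology, extremally disconnected, compact and Hausdorff, then $Y=X_0$. -/

import Mathlib

/-! Contact relations and clans on Boolean algebras, the contact algebra of regular closed
subsets of a topological space, C-semiregular spaces and u-points. -/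

namespace CSemi

/-- Precontact relations on a Boolean algebra: the axioms `(C0)` and `(C+)`. -/
structure IsPrecontact {B : Type*} [BooleanAlgebra B] (C : B → B → Prop) : Prop where
  ne_bot : ∀ a b, C a b → a ≠ ⊥ ∧ b ≠ ⊥
  sup_right : ∀ a b c, C a (b ⊔ c) ↔ C a b ∨ C a c
  sup_left : ∀ a b c, C (a ⊔ b) c ↔ C a c ∨ C b c

/-- Contact relations: reflexive (off `0`) and symmetric precontact relations. -/
structure IsContact {B : Type*} [BooleanAlgebra B] (C : B → B → Prop) : Prop
    extends IsPrecontact C where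
  refl : ∀ a, a ≠ ⊥ → C a a
  symm : ∀ a b, C a b → C b a

/-- The relation `C^#` associated with a relation `C` on a Boolean algebra. -/
def Sharp {B : Type*} [BooleanAlgebra B] (C : B → B → Prop) (a b : B) : Prop :=
  C a b ∨ C b a ∨ a ⊓ b ≠ ⊥

/-- For a contact relation, `C^#` is `C` itself. -/
theorem IsContact.sharp_iff {B : Type*} [BooleanAlgebra B] {C : B → B → Prop}
    (hC : IsContact C) (a b : B) : Sharp C a b ↔ C a b := by
  refine ⟨?_, Or.inl⟩
  rintro (h | h | h)
  · exact h
  · exact hC.symm _ _ h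
  · have h1 : C (a ⊓ b) (a ⊓ b) := hC.refl _ h
    have h2 : C ((a ⊓ b) ⊔ a) (a ⊓ b) := (hC.sup_left _ _ _).2 (Or.inl h1)
    rw [sup_eq_right.2 (inf_le_left : a ⊓ b ≤ a)] at h2
    have h3 : C a ((a ⊓ b) ⊔ b) := (hC.sup_right _ _ _).2 (Or.inl h2)
    rwa [sup_eq_right.2 (inf_le_right : a ⊓ b ≤ b)] at h3

/-- Clans of a Boolean algebra with a (pre)contact relation. -/
structure IsClan {B : Type*} [BooleanAlgebra B] (C : B → B → Prop) (Γ : Set B) : Prop where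
  nonempty : Γ.Nonempty
  bot_notMem : ⊥ ∉ Γ
  mem_of_le : ∀ a b, a ∈ Γ → a ≤ b → b ∈ Γ
  mem_or_mem : ∀ a b, a ⊔ b ∈ Γ → a ∈ Γ ∨ b ∈ Γ
  sharp : ∀ a b, a ∈ Γ → b ∈ Γ → Sharp C a b

/-- The set `RC(X)` of regular closed subsets of a space `X`, those with `F = cl (int F)`. -/
@[ext]
structure RC (X : Type*) [TopologicalSpace X] where
  /-- The underlying set. -/
  carrier : Set X
  isRegular : carrier = closure (interior carrier)

namespace RC

variable {X : Type*} [TopologicalSpace X]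

theorem isClosed (F : RC X) : IsClosed F.carrier := by
  rw [F.isRegular]; exact isClosed_closure

theorem closure_isRegular {U : Set X} (hU : IsOpen U) :
    closure U = closure (interior (closure U)) :=
  Set.Subset.antisymm (closure_mono (interior_maximal subset_closure hU))
    (closure_minimal interior_subset isClosed_closure)

theorem union_isRegular (F G : RC X) : F.carrier ∪ G.carrier = closure (interior (F.carrier ∪ G.carrier)) := by
  refine Set.Subset.antisymm (Set.union_subset ?_ ?_)
    (closure_minimal interior_subset (F.isClosed.union G.isClosed))
  · conv_lhs => rw [F.isRegular]
    exact closure_mono (interior_mono Set.subset_union_left)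
  · conv_lhs => rw [G.isRegular]
    exact closure_mono (interior_mono Set.subset_union_right)

/-- The Boolean algebra `RC(X)`: ordered by inclusion, with `a + b = a ∪ b`,
`a · b = cl (int (a ∩ b))`, `a* = cl (X \ a)`, `0 = ∅`, `1 = X`. -/
instance instBooleanAlgebra : BooleanAlgebra (RC X) where
  le F G := F.carrier ⊆ G.carrier
  le_refl F := Set.Subset.refl F.carrier
  le_trans _ _ _ h1 h2 := Set.Subset.trans h1 h2
  le_antisymm _ _ h1 h2 := RC.ext (Set.Subset.antisymm h1 h2)
  sup F G := ⟨F.carrier ∪ G.carrier, union_isRegular F G⟩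
  le_sup_left _ _ := Set.subset_union_left
  le_sup_right _ _ := Set.subset_union_right
  sup_le _ _ _ h1 h2 := Set.union_subset h1 h2
  inf F G := ⟨closure (interior (F.carrier ∩ G.carrier)), closure_isRegular isOpen_interior⟩
  inf_le_left F G :=
    closure_minimal (interior_subset.trans Set.inter_subset_left) F.isClosed
  inf_le_right F G :=
    closure_minimal (interior_subset.trans Set.inter_subset_right) G.isClosed
  le_inf F G H h1 h2 := by
    change F.carrier ⊆ closure (interior (G.carrier ∩ H.carrier))
    rw [F.isRegular]
    exact closure_mono (interior_mono (Set.subset_inter h1 h2))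
  le_sup_inf F G H := by
    change closure (interior ((F.carrier ∪ G.carrier) ∩ (F.carrier ∪ H.carrier))) ⊆
      F.carrier ∪ closure (interior (G.carrier ∩ H.carrier))
    refine closure_minimal ?_ (F.isClosed.union isClosed_closure)
    intro x hx
    by_cases hxF : x ∈ F.carrier
    · exact Or.inl hxF
    · refine Or.inr (subset_closure ?_)
      refine mem_interior.2 ⟨interior ((F.carrier ∪ G.carrier) ∩ (F.carrier ∪ H.carrier)) ∩ F.1ᶜ, ?_,
        isOpen_interior.inter F.isClosed.isOpen_compl, hx, hxF⟩
      rintro y ⟨hy, hyF⟩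
      obtain ⟨h1, h2⟩ := interior_subset hy
      exact ⟨h1.resolve_left hyF, h2.resolve_left hyF⟩
  top := ⟨Set.univ, by simp⟩
  bot := ⟨∅, by simp⟩
  compl F := ⟨closure F.1ᶜ, closure_isRegular F.isClosed.isOpen_compl⟩
  le_top F := Set.subset_univ F.carrier
  bot_le F := Set.empty_subset F.carrier
  inf_compl_le_bot F := by
    change closure (interior (F.carrier ∩ closure F.1ᶜ)) ⊆ ∅
    rw [interior_inter, closure_compl, interior_compl, ← F.isRegular]
    have h : interior F.carrier ∩ F.1ᶜ = ∅ :=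
      Set.eq_empty_of_forall_notMem fun x hx => hx.2 (interior_subset hx.1)
    rw [h, closure_empty]
  top_le_sup_compl F := by
    change Set.univ ⊆ F.carrier ∪ closure F.1ᶜ
    intro x _
    by_cases hx : x ∈ F.carrier
    · exact Or.inl hx
    · exact Or.inr (subset_closure hx)

/-- The standard contact relation `C_X` on `RC(X)`: the two sets meet. -/
def Contact (F G : RC X) : Prop := (F.carrier ∩ G.carrier).Nonempty

/-- `(RC(X), C_X)` is a contact algebra. -/
theorem isContact : IsContact (Contact (X := X)) where
  ne_bot a b := by
    rintro ⟨x, hxa, hxb⟩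
    constructor
    · rintro rfl; exact hxa
    · rintro rfl; exact hxb
  sup_right a b c := by
    change (a.carrier ∩ (b.carrier ∪ c.carrier)).Nonempty ↔ (a.carrier ∩ b.carrier).Nonempty ∨ (a.carrier ∩ c.carrier).Nonempty
    rw [Set.inter_union_distrib_left, Set.union_nonempty]
  sup_left a b c := by
    change ((a.carrier ∪ b.carrier) ∩ c.carrier).Nonempty ↔ (a.carrier ∩ c.carrier).Nonempty ∨ (b.carrier ∩ c.carrier).Nonempty
    rw [Set.union_inter_distrib_right, Set.union_nonempty]
  refl a ha := by
    change (a.carrier ∩ a.carrier).Nonempty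
    rw [Set.inter_self]
    by_contra h
    exact ha (RC.ext (Set.not_nonempty_iff_eq_empty.1 h))
  symm a b := by
    rintro ⟨x, hxa, hxb⟩
    exact ⟨x, hxb, hxa⟩

end RC

/-- A space is semiregular if `RC(X)` is a closed base: every closed set is an intersection of
regular closed sets. -/
def IsSemiregular (X : Type*) [TopologicalSpace X] : Prop :=
  ∀ A : Set X, IsClosed A → ∃ R : Set (RC X), A = ⋂ F ∈ R, F.carrier

/-- `σ_x`, the set of all regular closed sets containing `x`. -/
def sigma {X : Type*} [TopologicalSpace X] (x : X) : Set (RC X) := {F | x ∈ F.carrier}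

/-- C-semiregular spaces: semiregular `T_0`-spaces in which every clan of `(RC(X), C_X)` is
`σ_x` for some point `x`. -/
structure IsCSemiregular (X : Type*) [TopologicalSpace X] : Prop where
  t0 : T0Space X
  semiregular : IsSemiregular X
  clan : ∀ Γ : Set (RC X), IsClan RC.Contact Γ → ∃ x : X, Γ = sigma x

/-- u-points of a topological space. -/
def IsUPoint {X : Type*} [TopologicalSpace X] (x : X) : Prop :=
  ∀ U V : Set X, IsOpen U → IsOpen V → x ∈ closure U ∩ closure V → x ∈ closure (U ∩ V)

/-- The set of all u-points of `X`. -/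
def uPoints (X : Type*) [TopologicalSpace X] : Set X := {x | IsUPoint x}

end CSemi

/-! The idea is to read clans off ultrafilters. If `𝒰` is an ultrafilter on the set `X`, the
regular closed sets that belong to `𝒰` form a clan, which in a C-semiregular space is `σ_x` for
some `x`; semiregularity then makes `𝒰` converge to `x`. The point `x` is a u-point as soon as
`𝒰` respects the condition `cl U, cl V ∈ 𝒰 → cl (U ∩ V) ∈ 𝒰` for open `U, V`, and there are two
reasons why it may do so (`IsCSemiregular.exists_uPoint_of_ultrafilter`):

* `𝒰` contains all dense open sets, so that `U ∈ 𝒰` whenever `U` is open and `cl U ∈ 𝒰`. There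
  are such ultrafilters on every nonempty open set, whence the u-points are dense.
* `𝒰` contains the set of u-points. This gives compactness of that set.

If a u-point lies in the closure of an open set `U`, it lies in the interior of that closure
(`IsUPoint.mem_interior_closure`): otherwise it would lie in the closure of the empty set
`U ∩ (cl U)ᶜ`. So the regular closed sets cut out clopen subsets of the set of u-points, which
yields the Hausdorff property and extremal disconnectedness.

For uniqueness, in an extremally disconnected space every point is a u-point, and this property
passes from a dense subspace `Y` to the points of `Y` in `X`. Hence `Y` is contained in the
Hausdorff space of u-points; it is compact and dense there, so it is everything. -/

open Filter Topology

namespace CSemi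

variable {X : Type*} [TopologicalSpace X]

theorem mem_closure_preimage_val_iff {S U : Set X} (hS : Dense S) (hU : IsOpen U) (x : S) :
    x ∈ closure (Subtype.val ⁻¹' U : Set S) ↔ (x : X) ∈ closure U := by
  rw [closure_subtype, Subtype.image_preimage_coe, Set.inter_comm]
  exact ⟨fun h => closure_mono Set.inter_subset_left h,
    fun h => closure_minimal (hS.open_subset_closure_inter hU) isClosed_closure h⟩

/-- In a semiregular space the complements of the regular closed sets form a base. -/
theorem IsSemiregular.exists_RC (hX : IsSemiregular X) {W : Set X} (hW : IsOpen W) {x : X}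
    (hx : x ∈ W) : ∃ F : RC X, x ∉ F.carrier ∧ F.carrierᶜ ⊆ W := by
  obtain ⟨R, hR⟩ := hX Wᶜ hW.isClosed_compl
  have hx' : x ∉ ⋂ F ∈ R, F.carrier := hR ▸ fun h => h hx
  simp only [Set.mem_iInter, not_forall] at hx'
  obtain ⟨F, hF, hxF⟩ := hx'
  refine ⟨F, hxF, Set.compl_subset_comm.1 ?_⟩
  rw [hR]
  exact Set.biInter_subset_of_mem hF

/-- The regular closed sets belonging to an ultrafilter of sets form a clan. -/
theorem isClan_ultrafilter (𝒰 : Ultrafilter X) :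
    IsClan RC.Contact {F : RC X | F.carrier ∈ 𝒰} where
  nonempty := ⟨⊤, show (Set.univ : Set X) ∈ 𝒰 from Filter.univ_mem⟩
  bot_notMem := 𝒰.empty_notMem
  mem_of_le _ _ ha hab := Filter.mem_of_superset ha hab
  mem_or_mem _ _ h := Ultrafilter.union_mem_iff.1 h
  sharp _ _ ha hb := Or.inl (𝒰.nonempty_of_mem (Filter.inter_mem ha hb))

theorem IsCSemiregular.exists_le_nhds (hX : IsCSemiregular X) (𝒰 : Ultrafilter X) :
    ∃ x : X, ↑𝒰 ≤ 𝓝 x ∧ ∀ F : RC X, x ∈ F.carrier ↔ F.carrier ∈ 𝒰 := by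
  obtain ⟨x, hx⟩ := hX.clan _ (isClan_ultrafilter 𝒰)
  have hmem : ∀ F : RC X, x ∈ F.carrier ↔ F.carrier ∈ 𝒰 := fun F => (Set.ext_iff.1 hx F).symm
  refine ⟨x, fun N hN => ?_, hmem⟩
  obtain ⟨W, hWN, hW, hxW⟩ := mem_nhds_iff.1 hN
  obtain ⟨F, hxF, hFW⟩ := hX.semiregular.exists_RC hW hxW
  have hF : F.carrierᶜ ∈ 𝒰 := Ultrafilter.compl_mem_iff_notMem.2 fun h => hxF ((hmem F).2 h)
  exact Filter.mem_of_superset hF (hFW.trans hWN)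

theorem IsCSemiregular.exists_uPoint_of_ultrafilter (hX : IsCSemiregular X) (𝒰 : Ultrafilter X)
    (h𝒰 : ∀ U V : Set X, IsOpen U → IsOpen V → closure U ∈ 𝒰 → closure V ∈ 𝒰 →
      closure (U ∩ V) ∈ 𝒰) :
    ∃ x ∈ uPoints X, ↑𝒰 ≤ 𝓝 x ∧ ∀ F : RC X, x ∈ F.carrier ↔ F.carrier ∈ 𝒰 := by
  obtain ⟨x, hle, hmem⟩ := hX.exists_le_nhds 𝒰
  have hcl : ∀ U : Set X, IsOpen U → (x ∈ closure U ↔ closure U ∈ 𝒰) := fun U hU =>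
    hmem ⟨closure U, RC.closure_isRegular hU⟩
  exact ⟨x, fun U V hU hV h => (hcl _ (hU.inter hV)).2
    (h𝒰 U V hU hV ((hcl U hU).1 h.1) ((hcl V hV).1 h.2)), hle, hmem⟩

/-- The filter generated by the dense open sets: its members are the sets with dense interior. -/
def denseOpenFilter (X : Type*) [TopologicalSpace X] : Filter X where
  sets := {s | Dense (interior s)}
  univ_sets := by simp
  sets_of_superset hs hst := hs.mono (interior_mono hst)
  inter_sets hs ht := by
    rw [Set.mem_ofPred_eq, interior_inter]
    exact hs.inter_of_isOpen_left ht isOpen_interior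

/-- For `U` open, `U ∪ (closure U)ᶜ` is open and dense; so an ultrafilter containing the dense
open sets contains `U` along with its closure. -/
theorem mem_of_closure_mem {𝒰 : Ultrafilter X} (h𝒰 : ↑𝒰 ≤ denseOpenFilter X) {U : Set X}
    (hU : IsOpen U) (h : closure U ∈ 𝒰) : U ∈ 𝒰 := by
  have hopen : IsOpen (U ∪ (closure U)ᶜ) := hU.union isClosed_closure.isOpen_compl
  have hdense : U ∪ (closure U)ᶜ ∈ denseOpenFilter X := by
    change Dense (interior (U ∪ (closure U)ᶜ))
    rw [hopen.interior_eq]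
    intro x
    by_cases hx : x ∈ closure U
    · exact closure_mono Set.subset_union_left hx
    · exact subset_closure (Or.inr hx)
  refine Filter.mem_of_superset (Filter.inter_mem (h𝒰 hdense) h) ?_
  rintro x ⟨hx | hx, hx'⟩
  · exact hx
  · exact absurd hx' hx

theorem IsCSemiregular.dense_uPoints (hX : IsCSemiregular X) : Dense (uPoints X) := by
  refine dense_iff_inter_open.2 fun W hW ⟨w, hw⟩ => ?_
  obtain ⟨F, hwF, hFW⟩ := hX.semiregular.exists_RC hW hw
  have hne : (denseOpenFilter X ⊓ 𝓟 F.carrierᶜ).NeBot := by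
    rw [Filter.inf_principal_neBot_iff]
    intro s hs
    obtain ⟨y, hyF, hys⟩ := Dense.inter_open_nonempty hs _ F.isClosed.isOpen_compl ⟨w, hwF⟩
    exact ⟨y, interior_subset hys, hyF⟩
  obtain ⟨𝒰, h𝒰⟩ := Ultrafilter.exists_le (denseOpenFilter X ⊓ 𝓟 F.carrierᶜ)
  have hD : ↑𝒰 ≤ denseOpenFilter X := h𝒰.trans inf_le_left
  obtain ⟨x, hx, -, hmem⟩ := hX.exists_uPoint_of_ultrafilter 𝒰 fun U V hU hV h1 h2 =>
    Filter.mem_of_superset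
      (Filter.inter_mem (mem_of_closure_mem hD hU h1) (mem_of_closure_mem hD hV h2)) subset_closure
  have hF : F.carrierᶜ ∈ 𝒰 := Filter.le_principal_iff.1 (h𝒰.trans inf_le_right)
  exact ⟨x, hFW fun hxF => Ultrafilter.compl_mem_iff_notMem.1 hF ((hmem F).1 hxF), hx⟩

theorem IsCSemiregular.isCompact_uPoints (hX : IsCSemiregular X) : IsCompact (uPoints X) := by
  refine isCompact_iff_ultrafilter_le_nhds.2 fun 𝒰 h𝒰 => ?_
  obtain ⟨x, hx, hle, -⟩ := hX.exists_uPoint_of_ultrafilter 𝒰 fun U V hU hV h1 h2 =>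
    Filter.mem_of_superset (Filter.inter_mem (Filter.le_principal_iff.1 h𝒰)
      (Filter.inter_mem h1 h2)) fun y hy => hy.1 U V hU hV hy.2
  exact ⟨x, hx, hle⟩

theorem IsUPoint.mem_interior_closure {x : X} (hx : IsUPoint x) {U : Set X} (hU : IsOpen U)
    (hxU : x ∈ closure U) : x ∈ interior (closure U) := by
  by_contra h
  have h' : x ∈ closure (closure U)ᶜ := by rwa [closure_compl]
  have := hx U (closure U)ᶜ hU isClosed_closure.isOpen_compl ⟨hxU, h'⟩
  rw [Set.disjoint_iff_inter_eq_empty.1 (Set.disjoint_compl_right_iff_subset.2 subset_closure),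
    closure_empty] at this
  exact this

theorem IsCSemiregular.t2Space_uPoints (hX : IsCSemiregular X) : T2Space (uPoints X) := by
  have key : ∀ (x y : uPoints X) (W : Set X), IsOpen W → (x : X) ∈ W → (y : X) ∉ W →
      ∃ u v : Set (uPoints X), IsOpen u ∧ IsOpen v ∧ x ∈ u ∧ y ∈ v ∧ Disjoint u v := by
    intro x y W hW hxW hyW
    obtain ⟨F, hxF, hFW⟩ := hX.semiregular.exists_RC hW hxW
    have hyF : (y : X) ∈ closure (interior F.carrier) :=
      F.isRegular ▸ not_not.1 fun h => hyW (hFW h)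
    have hyF' := IsUPoint.mem_interior_closure y.2 isOpen_interior hyF
    rw [← F.isRegular] at hyF'
    exact ⟨Subtype.val ⁻¹' F.carrierᶜ, Subtype.val ⁻¹' interior F.carrier,
      F.isClosed.isOpen_compl.preimage continuous_subtype_val,
      isOpen_interior.preimage continuous_subtype_val, hxF, hyF',
      (Set.disjoint_compl_left_iff_subset.2 interior_subset).preimage _⟩
  refine ⟨fun x y hxy => ?_⟩
  have := hX.t0
  obtain ⟨W, hW, h | h⟩ := exists_isOpen_xor_mem (Subtype.coe_injective.ne hxy)
  · exact key x y W hW h.1 h.2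
  · obtain ⟨u, v, hu, hv, hyu, hxv, huv⟩ := key y x W hW h.1 h.2
    exact ⟨v, u, hv, hu, hxv, hyu, huv.symm⟩

theorem extremallyDisconnected_of_dense_uPoints (hd : Dense (uPoints X)) :
    ExtremallyDisconnected (uPoints X) := by
  refine ⟨fun O hO => ?_⟩
  obtain ⟨W, hW, rfl⟩ := isOpen_induced_iff.1 hO
  have h : closure (Subtype.val ⁻¹' W : Set (uPoints X)) =
      Subtype.val ⁻¹' interior (closure W) := by
    ext x
    rw [mem_closure_preimage_val_iff hd hW]
    exact ⟨IsUPoint.mem_interior_closure x.2 hW, fun h => interior_subset h⟩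
  rw [h]
  exact isOpen_interior.preimage continuous_subtype_val

theorem isUPoint_of_extremallyDisconnected [ExtremallyDisconnected X] (x : X) : IsUPoint x := by
  rintro U V hU hV ⟨hxU, hxV⟩
  -- Since `closure U` is open, `closure U ∩ closure V ⊆ closure (closure U ∩ V)`.
  have h := (ExtremallyDisconnected.open_closure U hU).inter_closure ⟨hxU, hxV⟩
  exact closure_minimal hV.closure_inter isClosed_closure h

theorem subset_uPoints_of_dense {Y : Set X} (hd : Dense Y) [ExtremallyDisconnected Y] :
    Y ⊆ uPoints X := by
  intro y hy U V hU hV h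
  rw [← mem_closure_preimage_val_iff hd (hU.inter hV) ⟨y, hy⟩]
  exact isUPoint_of_extremallyDisconnected (⟨y, hy⟩ : Y) _ _ (hU.preimage continuous_subtype_val)
    (hV.preimage continuous_subtype_val) ⟨(mem_closure_preimage_val_iff hd hU ⟨y, hy⟩).2 h.1,
      (mem_closure_preimage_val_iff hd hV ⟨y, hy⟩).2 h.2⟩

theorem eq_of_dense_of_isCompact {S Y : Set X} [T2Space S] (hd : Dense Y) (hc : IsCompact Y)
    (h : Y ⊆ S) : Y = S := by
  refine h.antisymm fun x hx => ?_
  have hcl : IsClosed (Subtype.val ⁻¹' Y : Set S) := by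
    refine IsCompact.isClosed ?_
    rw [Subtype.isCompact_iff, Subtype.image_preimage_coe, Set.inter_eq_right.2 h]
    exact hc
  have : (⟨x, hx⟩ : S) ∈ closure (Subtype.val ⁻¹' Y : Set S) := by
    rw [closure_subtype, Subtype.image_preimage_coe, Set.inter_eq_right.2 h]
    exact hd x
  rwa [hcl.closure_eq] at this

end CSemi

theorem theorem7p2 {X : Type*} [TopologicalSpace X] (hX : CSemi.IsCSemiregular X) :
    (Dense (CSemi.uPoints X) ∧ ExtremallyDisconnected (CSemi.uPoints X) ∧
      CompactSpace (CSemi.uPoints X) ∧ T2Space (CSemi.uPoints X)) ∧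
    ∀ Y : Set X, Dense Y → ExtremallyDisconnected Y → CompactSpace Y → T2Space Y →
      Y = CSemi.uPoints X := by
  have hT2 := hX.t2Space_uPoints
  refine ⟨⟨hX.dense_uPoints, CSemi.extremallyDisconnected_of_dense_uPoints hX.dense_uPoints,
    isCompact_iff_compactSpace.1 hX.isCompact_uPoints, hT2⟩, fun Y hd _ hc _ => ?_⟩
  exact CSemi.eq_of_dense_of_isCompact hd (isCompact_iff_compactSpace.2 hc)
    (CSemi.subset_uPoints_of_dense hd)
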